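/- Let $a_1,a_2,\dots$ be independent random vectors in $\mathbb{R}^p$ and $v_1,v_2,\dots$ real random variables on a probability space. For $N\ge 1$ let $A\in\mathbb{R}^{N\times p}$ be the random matrix with rows $a_1^T,\dots,a_N^T$, and let $x=A\theta_0+v$, where $\theta_0\in\mathbb{R}^p$ and $v=(v_1,\dots,v_N)^T$. Assume: (i) $P(|a_{ni}|\le\alpha)=1$ for all $n\ge 1$ and $1\le i\le p$; (ii) there is a positive definite matrix $M\in\mathbb{R}^{p\times p}$ such that $M=\frac1N E(A^TA)$ for every $N\ge 1$; let $\sigma_{\max}=\lambda_{\max}(M)$ and $\sigma_{\min}=\lambda_{\min}(M)>0$ be its largest and smallest eigenvalues; (iii) $(v_n)_{n\ge1}$ is a martingale difference sequence with respect to a filtration $(F_n)_{n\ge 0}$, that is, $v_n$ is integrable and $F_n$-measurable with $E(v_n\mid F_{n-1})=0$ for all $n\ge 1$; the sequence $(v_n)_{n\ge1}$ is independent of the sequence $(a_n)_{n\ge1}$; and $P(|v_n|\le b)=1$ for all $n\ge1$. Let $\hat\theta=(A^TA)^{-1}A^Tx$ be the least squares estimator, which is defined when $A^TA$ is invertible.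 Then for all $\varepsilon>0$, $r>0$ and every $$N>\max\left\{\frac{8\alpha^2b^2}{r^2\sigma_{\min}^2}\log\frac{2p}{\varepsilon},\ \frac43\,\frac{(6\sigma_{\max}+\sigma_{\min})(p\alpha^2+\sigma_{\max})}{\sigma_{\min}^2}\log\frac{2p}{\varepsilon}\right\}$$ one has $$P\bigl(A^TA\text{ is singular, or }\|\hat\theta-\theta_0\|_\infty>r\bigr)<\varepsilon .$$ In particular $P(\|\hat\theta-\theta_0\|_\infty>r)<\varepsilon$. -/

import Mathlib

open MeasureTheory ProbabilityTheory

/-- The largest (real) eigenvalue of a square matrix; the spectrum of a real matrix is its set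
of real eigenvalues. -/
noncomputable def lambdaMax {p : ℕ} (B : Matrix (Fin p) (Fin p) ℝ) : ℝ :=
  sSup (spectrum ℝ B)

/-- The smallest (real) eigenvalue of a square matrix. -/
noncomputable def lambdaMin {p : ℕ} (B : Matrix (Fin p) (Fin p) ℝ) : ℝ :=
  sInf (spectrum ℝ B)

/-- The `N × p` design matrix `A` whose rows are the first `N` terms of a sequence of vectors
(the sequence is indexed from `0`). -/
def designMatrix {p : ℕ} (a : ℕ → Fin p → ℝ) (N : ℕ) : Matrix (Fin N) (Fin p) ℝ :=
  Matrix.of fun n i => a n i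

/-- The observation vector `x = A θ₀ + v` for the first `N` samples. -/
def observation {p : ℕ} (a : ℕ → Fin p → ℝ) (v : ℕ → ℝ) (θ₀ : Fin p → ℝ) (N : ℕ) :
    Fin N → ℝ :=
  (designMatrix a N).mulVec θ₀ + fun n : Fin N => v n

/-- The least squares estimator `(Aᵀ A)⁻¹ Aᵀ x`. It is meaningful when `Aᵀ A` is invertible. -/
noncomputable def leastSquares {N p : ℕ} (A : Matrix (Fin N) (Fin p) ℝ) (x : Fin N → ℝ) :
    Fin p → ℝ :=
  (A.transpose * A)⁻¹.mulVec (A.transpose.mulVec x)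

/-- `v` is a martingale difference sequence for the filtration `ℱ`. With indices from `0`, the
`n`-th term is revealed at time `n + 1` and is centred given `ℱ n`. -/
structure IsMartingaleDifference {Ω : Type*} {m : MeasurableSpace Ω} (v : ℕ → Ω → ℝ)
    (ℱ : Filtration ℕ m) (P : Measure Ω) : Prop where
  adapted : ∀ n, StronglyMeasurable[ℱ (n + 1)] (v n)
  integrable : ∀ n, Integrable (v n) P
  condExp_eq_zero : ∀ n, P[v n | ℱ n] =ᵐ[P] 0

/-! ### Trace inequalities for powers of matrix products -/

namespace Matrix

open Filter Topology

variable {n : Type*} [Fintype n]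

/-! Write `G = Aᵀ A` for the Gram matrix, `σ = lambdaMin M`, `R = p α²` and `L = log (2p/ε)`. The
estimation error is `G⁻¹ Aᵀ v`, so two things must be controlled: the smallest eigenvalue of `G`,
and linear combinations of the noise.

For the first, a matrix Chernoff argument bounds `E tr exp(-θ G)`. Golden–Thompson splits off one
row at a time, `exp(-T) ≤ 1 - T + T²/2` linearises that row's factor, and independence replaces the
row's outer product by `M ≥ σ`. Markov's inequality then gives `G ≥ Nσ/2` outside an event of
probability at most `p exp(-Nσ/(8R))`. Golden–Thompson itself comes from Lie–Trotter and a trace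
inequality for powers `2 ^ k`.

For the second, the noise is independent of the design, so Fubini allows the design to be frozen.
The `i`-th error coordinate is then a weighted sum of martingale differences whose squared weights
add up to `(G⁻¹) i i ≤ 2/(Nσ)`, and Azuma–Hoeffding applies. A union bound over coordinates follows;
the lower bound on `N` makes each of the two contributions at most `ε/2`, the first strictly. -/

theorem sq_trace_mul_transpose_le (X Y : Matrix n n ℝ) :
    (X * Yᵀ).trace ^ 2 ≤ (X * Xᵀ).trace * (Y * Yᵀ).trace := by
  simp only [trace, diag_apply, mul_apply, transpose_apply, ← Finset.sum_product', ← pow_two]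
  exact Finset.sum_mul_sq_le_sq_mul_sq _ (fun x : n × n => X x.1 x.2) (fun x => Y x.1 x.2)

theorem trace_mul_transpose_self_nonneg (X : Matrix n n ℝ) : 0 ≤ (X * Xᵀ).trace := by
  simp only [trace, diag_apply, mul_apply, transpose_apply]
  exact Finset.sum_nonneg fun i _ => Finset.sum_nonneg fun j _ => mul_self_nonneg _

theorem trace_mul_pow_comm [DecidableEq n] (X Y : Matrix n n ℝ) (k : ℕ) :
    ((X * Y) ^ k).trace = ((Y * X) ^ k).trace := by
  cases k with
  | zero => simp
  | succ k =>
    have h : (X * Y) ^ (k + 1) = X * (Y * X) ^ k * Y := by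
      induction k with
      | zero => simp
      | succ k ih => rw [pow_succ, ih, pow_succ (Y * X)]; simp only [mul_assoc]
    rw [h, trace_mul_comm, ← mul_assoc, ← pow_succ']

/-- The two claims feed each other. The second at `k + 1` is the first at `k` for `Z = P * Q`, since
cyclicity turns `PQQP` into `P²Q²`, followed by the second at `k`. The first at `k + 1` applies both
at level `k` to `Z²`, reaching `(ZZᵀ)^(2^k) (ZᵀZ)^(2^k)`; as these factors have equal Frobenius
norm, Cauchy–Schwarz finishes. -/
theorem trace_pow_two_pow_aux [DecidableEq n] (k : ℕ) :
    (∀ Z : Matrix n n ℝ, (Z ^ 2 ^ (k + 1)).trace ≤ ((Z * Zᵀ) ^ 2 ^ k).trace) ∧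
    ∀ P Q : Matrix n n ℝ, P.IsSymm → Q.IsSymm →
      ((P * Q) ^ 2 ^ k).trace ≤ (P ^ 2 ^ k * Q ^ 2 ^ k).trace := by
  have cs : ∀ X Y : Matrix n n ℝ, (X * Xᵀ).trace = (Y * Yᵀ).trace →
      (X * Yᵀ).trace ≤ (X * Xᵀ).trace := fun X Y h => by
    have h1 := sq_trace_mul_transpose_le X Y
    rw [← h, ← pow_two] at h1
    exact le_of_abs_le (abs_le_of_sq_le_sq h1 (trace_mul_transpose_self_nonneg X))
  induction k with
  | zero =>
    refine ⟨fun Z => ?_, fun P Q _ _ => by simp⟩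
    have h := cs Z Zᵀ (by rw [transpose_transpose, trace_mul_comm])
    simpa [pow_two] using h
  | succ k ih =>
    obtain ⟨iha, ihb⟩ := ih
    have hb : ∀ P Q : Matrix n n ℝ, P.IsSymm → Q.IsSymm →
        ((P * Q) ^ 2 ^ (k + 1)).trace ≤ (P ^ 2 ^ (k + 1) * Q ^ 2 ^ (k + 1)).trace := by
      intro P Q hP hQ
      calc ((P * Q) ^ 2 ^ (k + 1)).trace ≤ ((P * Q * (P * Q)ᵀ) ^ 2 ^ k).trace := iha _
        _ = ((P * (Q ^ 2 * P)) ^ 2 ^ k).trace := by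
          rw [transpose_mul, hP, hQ]; simp only [pow_two, mul_assoc]
        _ = ((Q ^ 2 * P ^ 2) ^ 2 ^ k).trace := by
          rw [trace_mul_pow_comm, mul_assoc, ← pow_two]
        _ = ((P ^ 2 * Q ^ 2) ^ 2 ^ k).trace := trace_mul_pow_comm _ _ _
        _ ≤ ((P ^ 2) ^ 2 ^ k * (Q ^ 2) ^ 2 ^ k).trace := ihb _ _ (hP.pow 2) (hQ.pow 2)
        _ = _ := by simp only [← pow_mul, pow_succ' 2 k]
    refine ⟨fun Z => ?_, hb⟩
    have hP : (Zᵀ * Z).IsSymm := isSymm_transpose_mul_self Z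
    have hQ : (Z * Zᵀ).IsSymm := isSymm_mul_transpose_self Z
    calc (Z ^ 2 ^ (k + 1 + 1)).trace = ((Z ^ 2) ^ 2 ^ (k + 1)).trace := by
          rw [← pow_mul, ← pow_succ']
      _ ≤ ((Z ^ 2 * (Z ^ 2)ᵀ) ^ 2 ^ k).trace := iha _
      _ = ((Z * (Z * Zᵀ * Zᵀ)) ^ 2 ^ k).trace := by
          simp only [pow_two, transpose_mul, mul_assoc]
      _ = ((Z * Zᵀ * (Zᵀ * Z)) ^ 2 ^ k).trace := by
          rw [trace_mul_pow_comm]; simp only [mul_assoc]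
      _ ≤ ((Z * Zᵀ) ^ 2 ^ k * (Zᵀ * Z) ^ 2 ^ k).trace := ihb _ _ hQ hP
      _ = ((Z * Zᵀ) ^ 2 ^ k * ((Zᵀ * Z) ^ 2 ^ k)ᵀ).trace := by rw [(hP.pow _).eq]
      _ ≤ ((Z * Zᵀ) ^ 2 ^ k * ((Z * Zᵀ) ^ 2 ^ k)ᵀ).trace := by
          apply cs
          rw [(hP.pow _).eq, (hQ.pow _).eq, ← pow_add, ← pow_add, trace_mul_pow_comm]
      _ = _ := by rw [(hQ.pow _).eq, ← pow_add, ← two_mul, ← pow_succ']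

theorem trace_mul_pow_two_pow_le [DecidableEq n] {P Q : Matrix n n ℝ} (hP : P.IsSymm) (hQ : Q.IsSymm) (k : ℕ) :
    ((P * Q) ^ 2 ^ k).trace ≤ (P ^ 2 ^ k * Q ^ 2 ^ k).trace :=
  (trace_pow_two_pow_aux k).2 P Q hP hQ

end Matrix

/-! ### Lie–Trotter product formula -/

section LieTrotter

open Filter Topology

variable {𝔸 : Type*} [NormedRing 𝔸]

theorem norm_normedSpaceExp_le [NormedAlgebra ℝ 𝔸] [CompleteSpace 𝔸] [NormOneClass 𝔸] (x : 𝔸) : ‖NormedSpace.exp x‖ ≤ Real.exp ‖x‖ := by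
  rw [congrFun (NormedSpace.exp_eq_tsum ℝ) x]
  have h := NormedSpace.exp_series_hasSum_exp' (𝕂 := ℝ) ‖x‖
  rw [← Real.exp_eq_exp_ℝ] at h
  refine tsum_of_norm_bounded h fun k => ?_
  rw [norm_smul, smul_eq_mul, Real.norm_of_nonneg (by positivity)]
  gcongr
  exact norm_pow_le x k

/-- Telescoping. Taking `1 ≤ K` permits `K ^ k` in place of the sharper `K ^ (k - 1)` and avoids
natural subtraction. -/
theorem norm_pow_sub_pow_le [NormOneClass 𝔸] {X Y : 𝔸} {K : ℝ} (hK : 1 ≤ K) (hX : ‖X‖ ≤ K)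
    (hY : ‖Y‖ ≤ K) (k : ℕ) :
    ‖X ^ k - Y ^ k‖ ≤ k * K ^ k * ‖X - Y‖ := by
  induction k with
  | zero => simp
  | succ k ih =>
    have h : X ^ (k + 1) - Y ^ (k + 1) = X ^ k * (X - Y) + (X ^ k - Y ^ k) * Y := by
      rw [pow_succ, pow_succ]; noncomm_ring
    have hXk : ‖X ^ k‖ ≤ K ^ k := (norm_pow_le X k).trans (by gcongr)
    calc ‖X ^ (k + 1) - Y ^ (k + 1)‖ ≤ ‖X ^ k‖ * ‖X - Y‖ + ‖X ^ k - Y ^ k‖ * ‖Y‖ := by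
          rw [h]
          exact (norm_add_le _ _).trans (add_le_add (norm_mul_le _ _) (norm_mul_le _ _))
      _ ≤ K ^ (k + 1) * ‖X - Y‖ + k * K ^ k * ‖X - Y‖ * K := by
          gcongr
          exact hXk.trans (pow_le_pow_right₀ hK k.le_succ)
      _ = _ := by push_cast; ring

/-- The two curves agree to first order at `0`, so their difference has zero derivative there; the
sequence is the norm of its slope at `1/k`. -/
theorem tendsto_nat_mul_norm_exp_sub [NormedAlgebra ℝ 𝔸] [CompleteSpace 𝔸] (A B : 𝔸) :
    Tendsto (fun k : ℕ => (k : ℝ) * ‖NormedSpace.exp ((k : ℝ)⁻¹ • (A + B)) -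
      NormedSpace.exp ((k : ℝ)⁻¹ • A) * NormedSpace.exp ((k : ℝ)⁻¹ • B)‖) atTop (𝓝 0) := by
  have hd : HasDerivAt (fun t : ℝ => NormedSpace.exp (t • (A + B)) -
      NormedSpace.exp (t • A) * NormedSpace.exp (t • B)) 0 0 := by
    have h := (hasDerivAt_exp_smul_const (A + B) (0 : ℝ)).sub
      ((hasDerivAt_exp_smul_const A (0 : ℝ)).mul (hasDerivAt_exp_smul_const B (0 : ℝ)))
    simpa using! h
  have ht : Tendsto (fun k : ℕ => (k : ℝ)⁻¹) atTop (𝓝[≠] 0) :=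
    tendsto_nhdsWithin_iff.mpr ⟨tendsto_inv_atTop_nhds_zero_nat, by
      filter_upwards [eventually_gt_atTop 0] with k hk
      simpa using hk.ne'⟩
  have h := (hd.tendsto_slope_zero.comp ht).norm
  simp only [norm_zero] at h
  refine h.congr fun k => ?_
  simp [norm_smul]

/-- The **Lie–Trotter product formula**. -/
theorem tendsto_exp_mul_exp_pow [NormedAlgebra ℝ 𝔸] [CompleteSpace 𝔸] [NormOneClass 𝔸]
    (A B : 𝔸) :
    Tendsto (fun k : ℕ => (NormedSpace.exp ((k : ℝ)⁻¹ • A) * NormedSpace.exp ((k : ℝ)⁻¹ • B)) ^ k)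
      atTop (𝓝 (NormedSpace.exp (A + B))) := by
  have h := (tendsto_nat_mul_norm_exp_sub A B).const_mul (Real.exp (‖A‖ + ‖B‖))
  rw [mul_zero] at h
  rw [tendsto_iff_norm_sub_tendsto_zero]
  refine squeeze_zero' (Eventually.of_forall fun _ => norm_nonneg _) ?_ h
  filter_upwards [eventually_gt_atTop 0] with k hk
  have hk0 : (k : ℝ) ≠ 0 := by positivity
  have hXk : NormedSpace.exp (A + B) = NormedSpace.exp ((k : ℝ)⁻¹ • (A + B)) ^ k := by
    let _ := NormedAlgebra.restrictScalars ℚ ℝ 𝔸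
    rw [← NormedSpace.exp_nsmul, ← Nat.cast_smul_eq_nsmul ℝ, smul_inv_smul₀ hk0]
  have hsm : ∀ C : 𝔸, ‖(k : ℝ)⁻¹ • C‖ = (k : ℝ)⁻¹ * ‖C‖ := fun C => by
    rw [norm_smul, norm_inv, Real.norm_natCast]
  set K := Real.exp ((k : ℝ)⁻¹ * (‖A‖ + ‖B‖))
  have hK : 1 ≤ K := Real.one_le_exp (by positivity)
  have hX : ‖NormedSpace.exp ((k : ℝ)⁻¹ • (A + B))‖ ≤ K := by
    refine (norm_normedSpaceExp_le _).trans (Real.exp_le_exp.mpr ?_)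
    rw [hsm]
    gcongr
    exact norm_add_le A B
  have hY : ‖NormedSpace.exp ((k : ℝ)⁻¹ • A) * NormedSpace.exp ((k : ℝ)⁻¹ • B)‖ ≤ K := by
    refine (norm_mul_le _ _).trans ?_
    refine (mul_le_mul (norm_normedSpaceExp_le _) (norm_normedSpaceExp_le _) (norm_nonneg _)
      (Real.exp_pos _).le).trans_eq ?_
    rw [← Real.exp_add, hsm, hsm, ← mul_add]
  have hKk : K ^ k = Real.exp (‖A‖ + ‖B‖) := by
    rw [← Real.exp_nat_mul, ← mul_assoc, mul_inv_cancel₀ hk0, one_mul]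
  rw [hXk, norm_sub_rev]
  refine (norm_pow_sub_pow_le hK hX hY k).trans_eq ?_
  rw [hKk]; ring

end LieTrotter

/-! ### Golden–Thompson inequality -/

namespace Matrix

open Filter Topology

variable {n : Type*} [Fintype n] [DecidableEq n]

open scoped Norms.Operator in
theorem tendsto_exp_mul_exp_pow [Nonempty n] (A B : Matrix n n ℝ) :
    Tendsto (fun k : ℕ => (NormedSpace.exp ((k : ℝ)⁻¹ • A) * NormedSpace.exp ((k : ℝ)⁻¹ • B)) ^ k)
      atTop (𝓝 (NormedSpace.exp (A + B))) :=
  _root_.tendsto_exp_mul_exp_pow A B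

open scoped Norms.Operator in
theorem continuous_exp : Continuous (NormedSpace.exp : Matrix n n ℝ → Matrix n n ℝ) := by
  let _ := NormedAlgebra.restrictScalars ℚ ℝ (Matrix n n ℝ)
  exact NormedSpace.exp_continuous

/-- The **Golden–Thompson inequality** for real symmetric matrices. -/
theorem trace_exp_add_le {A B : Matrix n n ℝ} (hA : A.IsSymm) (hB : B.IsSymm) :
    (NormedSpace.exp (A + B)).trace ≤ (NormedSpace.exp A * NormedSpace.exp B).trace := by
  cases isEmpty_or_nonempty n with
  | inl h => simp [trace]
  | inr h =>
    -- Lie–Trotter along the exponents `2 ^ k`, the only ones covered by the trace inequality.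
    have hlim : Tendsto (fun k : ℕ => ((NormedSpace.exp (((2 ^ k : ℕ) : ℝ)⁻¹ • A) *
        NormedSpace.exp (((2 ^ k : ℕ) : ℝ)⁻¹ • B)) ^ 2 ^ k).trace) atTop
        (𝓝 (NormedSpace.exp (A + B)).trace) := by
      have h := (tendsto_exp_mul_exp_pow A B).comp
        (tendsto_pow_atTop_atTop_of_one_lt (one_lt_two : (1 : ℕ) < 2))
      exact ((continuous_id.matrix_trace).tendsto _).comp h
    refine le_of_tendsto' hlim fun k => ?_
    have hk : ((2 ^ k : ℕ) : ℝ) ≠ 0 := by positivity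
    have he : ∀ C : Matrix n n ℝ,
        NormedSpace.exp (((2 ^ k : ℕ) : ℝ)⁻¹ • C) ^ 2 ^ k = NormedSpace.exp C := fun C => by
      rw [← exp_nsmul, ← Nat.cast_smul_eq_nsmul ℝ, smul_inv_smul₀ hk]
    have h := trace_mul_pow_two_pow_le (hA.smul ((2 ^ k : ℕ) : ℝ)⁻¹).exp
      (hB.smul ((2 ^ k : ℕ) : ℝ)⁻¹).exp k
    rwa [he, he] at h

end Matrix

/-! ### Positive semidefinite order and functional calculus -/

namespace Matrix

variable {n : Type*}

theorem posDef_of_posSemidef_sub_smul_one [DecidableEq n] {T : Matrix n n ℝ} {c : ℝ} (hc : 0 < c)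
    (h : (T - c • (1 : Matrix n n ℝ)).PosSemidef) : T.PosDef := by
  have := (PosDef.one (n := n) (R := ℝ)).smul hc
  simpa using PosDef.posSemidef_add h this

variable [Fintype n]

/-- With `P = Bᴴ B`, cyclicity gives the trace of `B Q Bᴴ`. -/
theorem PosSemidef.trace_mul_nonneg {P Q : Matrix n n ℝ} (hP : P.PosSemidef)
    (hQ : Q.PosSemidef) : 0 ≤ (P * Q).trace := by
  classical
  obtain ⟨B, rfl⟩ : ∃ B : Matrix n n ℝ, P = Bᴴ * B := by
    open scoped MatrixOrder in
    exact CStarAlgebra.nonneg_iff_eq_star_mul_self.mp hP.nonneg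
  rw [mul_assoc, trace_mul_comm, mul_assoc]
  have h := (hQ.mul_mul_conjTranspose_same B).trace_nonneg
  rwa [mul_assoc] at h

variable [DecidableEq n]

theorem IsHermitian.exists_eq_mul_diagonal {T : Matrix n n ℝ} (hT : T.IsHermitian) :
    ∃ (U : Matrix n n ℝ) (d : n → ℝ), U * Uᵀ = 1 ∧ Uᵀ * U = 1 ∧ T = U * diagonal d * Uᵀ ∧
      ∀ i, d i ∈ spectrum ℝ T := by
  have hs := hT.spectral_theorem
  rw [Unitary.conjStarAlgAut_apply] at hs
  refine ⟨hT.eigenvectorUnitary, hT.eigenvalues, ?_, ?_, ?_, hT.eigenvalues_mem_spectrum_real⟩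
  · exact (Matrix.mem_unitaryGroup_iff).mp hT.eigenvectorUnitary.2
  · exact (Matrix.mem_unitaryGroup_iff').mp hT.eigenvectorUnitary.2
  · simpa using! hs

theorem exp_mul_diagonal_mul {U : Matrix n n ℝ} (h : U * Uᵀ = 1) (d : n → ℝ) :
    NormedSpace.exp (U * diagonal d * Uᵀ) = U * diagonal (fun i => Real.exp (d i)) * Uᵀ := by
  have hinv : U⁻¹ = Uᵀ := inv_eq_right_inv h
  have hU : IsUnit U := ⟨⟨U, Uᵀ, h, mul_eq_one_comm.mp h⟩, rfl⟩
  rw [← hinv, exp_conj _ _ hU, exp_diagonal]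
  congr 3
  ext i
  rw [Pi.coe_exp, Real.exp_eq_exp_ℝ]

theorem posSemidef_mul_diagonal_mul (U : Matrix n n ℝ) {d : n → ℝ} (hd : ∀ i, 0 ≤ d i) :
    (U * diagonal d * Uᵀ).PosSemidef := by
  have h := (PosSemidef.diagonal (R := ℝ) (n := n) (d := d) hd).mul_mul_conjTranspose_same U
  rwa [conjTranspose_eq_transpose_of_trivial] at h

theorem IsHermitian.posSemidef_exp {T : Matrix n n ℝ} (hT : T.IsHermitian) :
    (NormedSpace.exp T).PosSemidef := by
  obtain ⟨U, d, h1, -, rfl, -⟩ := hT.exists_eq_mul_diagonal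
  rw [exp_mul_diagonal_mul h1]
  exact posSemidef_mul_diagonal_mul U fun i => (Real.exp_pos _).le

theorem IsHermitian.posSemidef_sub_smul_one {T : Matrix n n ℝ} (hT : T.IsHermitian) {c : ℝ}
    (hc : ∀ x ∈ spectrum ℝ T, c ≤ x) : (T - c • (1 : Matrix n n ℝ)).PosSemidef := by
  obtain ⟨U, d, h1, -, hTd, hd⟩ := hT.exists_eq_mul_diagonal
  have h : T - c • (1 : Matrix n n ℝ) = U * diagonal (fun i => d i - c) * Uᵀ := by
    rw [← diagonal_sub, Matrix.mul_sub, Matrix.sub_mul, ← hTd, ← smul_one_eq_diagonal]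
    simp [h1]
  rw [h]
  exact posSemidef_mul_diagonal_mul U fun i => sub_nonneg.mpr (hc _ (hd i))

/-- The trace is the sum of `exp(-θ d i)` over the eigenvalues, so it dominates each term. Stating
the good event through this trace makes its measurability a matter of continuity. -/
theorem IsHermitian.posSemidef_sub_smul_one_of_trace_exp_lt {T : Matrix n n ℝ}
    (hT : T.IsHermitian) {θ c : ℝ} (hθ : 0 < θ)
    (h : (NormedSpace.exp (-(θ • T))).trace < Real.exp (-(θ * c))) :
    (T - c • (1 : Matrix n n ℝ)).PosSemidef := by
  obtain ⟨U, d, h1, h2, hTd, -⟩ := hT.exists_eq_mul_diagonal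
  have he : -(θ • T) = U * diagonal (fun i => -(θ * d i)) * Uᵀ := by
    rw [hTd, ← diagonal_neg, Matrix.mul_neg, Matrix.neg_mul]
    congr 1
    rw [← Matrix.smul_mul, ← Matrix.mul_smul, ← diagonal_smul]
    rfl
  rw [he, exp_mul_diagonal_mul h1, trace_mul_comm, ← mul_assoc, h2, one_mul, trace_diagonal] at h
  have hd : ∀ i, c ≤ d i := fun i => by
    have hi := (Finset.single_le_sum (f := fun i => Real.exp (-(θ * d i)))
      (fun j _ => (Real.exp_pos _).le) (Finset.mem_univ i)).trans_lt h
    have := Real.exp_lt_exp.mp hi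
    exact (lt_of_mul_lt_mul_left (neg_lt_neg_iff.mp this) hθ.le).le
  have h : T - c • (1 : Matrix n n ℝ) = U * diagonal (fun i => d i - c) * Uᵀ := by
    rw [← diagonal_sub, Matrix.mul_sub, Matrix.sub_mul, ← hTd, ← smul_one_eq_diagonal]
    simp [h1]
  rw [h]
  exact posSemidef_mul_diagonal_mul U fun i => sub_nonneg.mpr (hd i)

theorem _root_.Real.exp_neg_le_one_sub_add_sq {x : ℝ} (hx : 0 ≤ x) :
    Real.exp (-x) ≤ 1 - x + x ^ 2 / 2 := by
  have h := Real.quadratic_le_exp_of_nonneg hx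
  rw [Real.exp_neg, inv_le_iff_one_le_mul₀ (Real.exp_pos x)]
  have hp : 0 < 1 - x + x ^ 2 / 2 := by nlinarith [sq_nonneg (x - 1)]
  -- The product equals `1 + x⁴/4`.
  calc 1 ≤ (1 - x + x ^ 2 / 2) * (1 + x + x ^ 2 / 2) := by nlinarith [sq_nonneg (x ^ 2)]
    _ ≤ _ := by gcongr

theorem PosSemidef.posSemidef_sub_exp_neg {T : Matrix n n ℝ} (hT : T.PosSemidef) :
    (1 - T + (1 / 2 : ℝ) • (T * T) - NormedSpace.exp (-T)).PosSemidef := by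
  obtain ⟨U, d, h1, h2, hTd, -⟩ := hT.isHermitian.exists_eq_mul_diagonal
  have hd0 : ∀ i, 0 ≤ d i := by
    have h := hT.conjTranspose_mul_mul_same U
    have hU : Uᵀ * T * U = diagonal d := by
      calc Uᵀ * T * U = Uᵀ * U * diagonal d * (Uᵀ * U) := by
            conv_lhs => rw [hTd]
            simp only [mul_assoc]
        _ = diagonal d := by rw [h2, one_mul, mul_one]
    rw [conjTranspose_eq_transpose_of_trivial, hU] at h
    exact posSemidef_diagonal_iff.mp h
  have hn : -T = U * diagonal (fun i => -d i) * Uᵀ := by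
    rw [hTd, ← diagonal_neg, Matrix.mul_neg, Matrix.neg_mul]
  have hsq : T * T = U * diagonal (fun i => d i * d i) * Uᵀ := by
    rw [hTd, ← diagonal_mul_diagonal]
    calc _ = U * diagonal d * (Uᵀ * U) * diagonal d * Uᵀ := by simp only [mul_assoc]
      _ = _ := by rw [h2]; simp only [mul_assoc, one_mul]
  have h : 1 - T + (1 / 2 : ℝ) • (T * T) - NormedSpace.exp (-T) =
      U * diagonal (fun i => 1 - d i + (1 / 2 : ℝ) * (d i * d i) - Real.exp (-d i)) * Uᵀ := by
    rw [hn, exp_mul_diagonal_mul h1, hsq, hTd, ← h1, ← diagonal_sub, ← diagonal_add,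
      ← diagonal_sub]
    have : diagonal (fun i => (1 / 2 : ℝ) * (d i * d i)) =
      (1 / 2 : ℝ) • diagonal (fun i => d i * d i) := by
        rw [← diagonal_smul]; rfl
    rw [this]
    simp only [Matrix.mul_sub, Matrix.sub_mul, Matrix.mul_add, Matrix.add_mul, diagonal_one,
      mul_one, Matrix.mul_smul, Matrix.smul_mul]
  rw [h]
  refine posSemidef_mul_diagonal_mul U fun i => ?_
  have := Real.exp_neg_le_one_sub_add_sq (hd0 i)
  nlinarith

/-- For `y = T⁻¹ eᵢ` one has `c yᵢ² ≤ c |y|² ≤ yᵀ T y = yᵢ`, and `yᵢ` is the diagonal entry. -/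
theorem inv_diag_le_of_posSemidef_sub_smul_one {T : Matrix n n ℝ} {c : ℝ} (hc : 0 < c)
    (h : (T - c • (1 : Matrix n n ℝ)).PosSemidef) (i : n) : T⁻¹ i i ≤ 1 / c := by
  have hT := (posDef_of_posSemidef_sub_smul_one hc h)
  have hu : IsUnit T.det := (isUnit_iff_isUnit_det T).mp hT.isUnit
  set y := T⁻¹ *ᵥ Pi.single i 1 with hy
  have hTy : T *ᵥ y = Pi.single i 1 := by
    rw [hy, mulVec_mulVec, mul_nonsing_inv _ hu, one_mulVec]
  have hyi : y i = T⁻¹ i i := by simp [hy]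
  have hq := h.dotProduct_mulVec_nonneg y
  rw [sub_mulVec, hTy, dotProduct_sub, smul_mulVec, one_mulVec] at hq
  simp only [star_trivial, dotProduct_single, mul_one, dotProduct_smul, smul_eq_mul] at hq
  have hyy : y i * y i ≤ y ⬝ᵥ y :=
    Finset.single_le_sum (f := fun j => y j * y j) (fun j _ => mul_self_nonneg _)
      (Finset.mem_univ i)
  rw [← hyi, le_div_iff₀ hc]
  have h1 : c * (y i * y i) ≤ c * (y ⬝ᵥ y) := by gcongr
  by_contra! hlt
  have hpos : 0 < y i := pos_of_mul_pos_left (one_pos.trans hlt) hc.le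
  nlinarith

end Matrix

/-! ### Extreme eigenvalues and the Gram matrix -/

theorem lambdaMin_le_of_mem_spectrum {p : ℕ} {B : Matrix (Fin p) (Fin p) ℝ} {x : ℝ}
    (hx : x ∈ spectrum ℝ B) : lambdaMin B ≤ x :=
  csInf_le (Matrix.finite_real_spectrum (𝕜 := ℝ)).bddBelow hx

theorem lambdaMin_le_lambdaMax {p : ℕ} [NeZero p] {B : Matrix (Fin p) (Fin p) ℝ}
    (hB : B.IsHermitian) : lambdaMin B ≤ lambdaMax B :=
  csInf_le_csSup ⟨_, hB.eigenvalues_mem_spectrum_real 0⟩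
    (Matrix.finite_real_spectrum (𝕜 := ℝ)).bddBelow
    (Matrix.finite_real_spectrum (𝕜 := ℝ)).bddAbove

/-- The spectrum is empty and `sInf ∅ = 0`; hence positivity of `lambdaMin M` excludes `p = 0`. -/
theorem lambdaMin_of_isEmpty (B : Matrix (Fin 0) (Fin 0) ℝ) : lambdaMin B = 0 := by
  simp [lambdaMin]

open Matrix in
/-- The Gram matrix `∑ aₘ aₘᵀ` of the first `k` terms of a sequence of vectors. -/
def gramSum {ι : Type*} (a : ℕ → ι → ℝ) (k : ℕ) : Matrix ι ι ℝ :=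
  ∑ m ∈ Finset.range k, vecMulVec (a m) (a m)

/-! ### Rank-one updates of the Gram matrix -/

namespace Matrix

variable {ι : Type*} [Fintype ι]

theorem posSemidef_vecMulVec_self (x : ι → ℝ) : (vecMulVec x x).PosSemidef := by
  simpa using posSemidef_vecMulVec_self_star x

theorem _root_.posSemidef_gramSum (a : ℕ → ι → ℝ) (k : ℕ) : (gramSum a k).PosSemidef :=
  posSemidef_sum _ fun m _ => posSemidef_vecMulVec_self (a m)

/-- One step of the matrix Chernoff bound, before taking expectations. -/
theorem trace_exp_neg_add_vecMulVec_le [DecidableEq ι] {S : Matrix ι ι ℝ} (hS : S.IsHermitian)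
    {x : ι → ℝ} {R θ : ℝ} (hx : x ⬝ᵥ x ≤ R) (hθ : 0 ≤ θ) :
    (NormedSpace.exp (-(θ • (S + vecMulVec x x)))).trace ≤
      (NormedSpace.exp (-(θ • S))).trace -
        θ * (1 - θ * R / 2) * (NormedSpace.exp (-(θ • S)) * vecMulVec x x).trace := by
  set X := vecMulVec x x with hX
  have hXp : X.PosSemidef := posSemidef_vecMulVec_self x
  have hSh : (-(θ • S)).IsHermitian := by
    have h : (θ • S).IsHermitian := by
      rw [IsHermitian, conjTranspose_smul, hS.eq, star_trivial]
    exact h.neg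
  have hθX : (θ • X).PosSemidef := hXp.smul hθ
  set F := NormedSpace.exp (-(θ • S))
  have hF : F.PosSemidef := hSh.posSemidef_exp
  -- The quadratic term is thus at most `R X`, so the bound on the exponential becomes linear in
  -- `X`.
  have hXX : X * X = (x ⬝ᵥ x) • X := by
    rw [hX, vecMulVec_mul_vecMulVec, vecMulVec_smul]
  have hgt : (NormedSpace.exp (-(θ • (S + X)))).trace ≤
      (F * NormedSpace.exp (-(θ • X))).trace := by
    rw [smul_add, neg_add]
    refine trace_exp_add_le ?_ ?_
    · simpa using hSh
    · simpa using hθX.isHermitian.neg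
  have h1 := hF.trace_mul_nonneg hθX.posSemidef_sub_exp_neg
  have h2 := hF.trace_mul_nonneg (hXp.smul (sub_nonneg.mpr hx))
  rw [Matrix.smul_mul, Matrix.mul_smul, hXX] at h1
  simp only [Matrix.mul_sub, Matrix.mul_add, Matrix.mul_smul, trace_sub, trace_add, trace_smul,
    mul_one, smul_eq_mul] at h1 h2
  have h3 := mul_nonneg (mul_nonneg hθ hθ) h2
  linarith

end Matrix

/-! ### Matrix Chernoff lower tail -/

section Chernoff

open Matrix

variable {Ω : Type*} {m : MeasurableSpace Ω} {P : Measure Ω}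

variable {ι : Type*} [Fintype ι] {a : ℕ → Ω → ι → ℝ} {α : ℝ}

theorem continuous_exp_gram_apply [DecidableEq ι] (θ : ℝ) (s : Finset ℕ) (i j : ι) :
    Continuous fun x : s → ι → ℝ =>
      NormedSpace.exp (-(θ • ∑ k : s, vecMulVec (x k) (x k))) i j := by
  refine (Matrix.continuous_exp.comp ?_).matrix_elem i j
  refine (Continuous.const_smul (continuous_finsetSum _ fun k _ => ?_) θ).neg
  exact (continuous_apply k).matrix_vecMulVec (continuous_apply k)

/-- Exhibits the exponential as a function of the finite block of rows before `k`, as needed for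
independence from row `k` and for boundedness on a compact box. -/
theorem exp_gramSum_eq [DecidableEq ι] (θ : ℝ) (k : ℕ) (ω : Ω) :
    NormedSpace.exp (-(θ • gramSum (fun n => a n ω) k)) =
      NormedSpace.exp (-(θ • ∑ l : Finset.range k, vecMulVec (a l ω) (a l ω))) := by
  rw [gramSum, ← Finset.sum_coe_sort]

theorem indepFun_exp_gramSum_apply [DecidableEq ι] (ha : ∀ n, Measurable (a n))
    (hind : iIndepFun a P) (θ : ℝ) (k : ℕ) (i j i' j' : ι) :
    IndepFun (fun ω => NormedSpace.exp (-(θ • gramSum (fun n => a n ω) k)) i j)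
      (fun ω => a k ω i' * a k ω j') P := by
  have h := hind.indepFun_finset (Finset.range k) {k} (by simp) ha
  have hψ : Measurable fun x : ({k} : Finset ℕ) → ι → ℝ =>
      x ⟨k, by simp⟩ i' * x ⟨k, by simp⟩ j' := by fun_prop
  have h2 := h.comp (continuous_exp_gram_apply θ (Finset.range k) i j).measurable hψ
  simp only [exp_gramSum_eq]
  exact h2

variable [IsProbabilityMeasure P]

theorem integrable_comp_of_ae_mem_compact {E : Type*} [TopologicalSpace E] [MeasurableSpace E]
    [OpensMeasurableSpace E] {X : Ω → E} (hX : Measurable X) {K : Set E} (hK : IsCompact K)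
    (hXK : ∀ᵐ ω ∂P, X ω ∈ K) {g : E → ℝ} (hg : Continuous g) :
    Integrable (fun ω => g (X ω)) P := by
  obtain ⟨C, hC⟩ := hK.exists_bound_of_continuousOn hg.continuousOn
  refine Integrable.of_bound (hg.measurable.comp hX).aestronglyMeasurable C ?_
  filter_upwards [hXK] with ω hω using hC _ hω

theorem integrable_comp_design (ha : ∀ n, Measurable (a n))
    (hb : ∀ n i, ∀ᵐ ω ∂P, |a n ω i| ≤ α) (s : Finset ℕ) {g : (s → ι → ℝ) → ℝ}
    (hg : Continuous g) : Integrable (fun ω => g fun k : s => a k ω) P := by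
  refine integrable_comp_of_ae_mem_compact (X := fun ω (k : s) => a k ω)
    (measurable_pi_lambda _ fun k => ha k)
    (isCompact_Icc (a := fun _ _ => -α) (b := fun _ _ => α)) ?_ hg
  have h : ∀ᵐ ω ∂P, ∀ n i, |a n ω i| ≤ α := ae_all_iff.mpr fun n => ae_all_iff.mpr fun i => hb n i
  filter_upwards [h] with ω hω
  exact ⟨fun k i => (abs_le.mp (hω k i)).1, fun k i => (abs_le.mp (hω k i)).2⟩

theorem integrable_exp_gramSum_apply [DecidableEq ι] (ha : ∀ n, Measurable (a n))
    (hb : ∀ n i, ∀ᵐ ω ∂P, |a n ω i| ≤ α) (θ : ℝ) (k : ℕ) (i j : ι) :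
    Integrable (fun ω => NormedSpace.exp (-(θ • gramSum (fun n => a n ω) k)) i j) P := by
  simp only [exp_gramSum_eq]
  exact integrable_comp_design ha hb (Finset.range k) (continuous_exp_gram_apply θ _ i j)

theorem integrable_mul_apply (ha : ∀ n, Measurable (a n))
    (hb : ∀ n i, ∀ᵐ ω ∂P, |a n ω i| ≤ α) (n : ℕ) (i j : ι) :
    Integrable (fun ω => a n ω i * a n ω j) P :=
  integrable_comp_design ha hb {n} (g := fun x => x ⟨n, by simp⟩ i * x ⟨n, by simp⟩ j)
    (by fun_prop)

theorem integral_trace_exp_gramSum_mul [DecidableEq ι] (ha : ∀ n, Measurable (a n))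
    (hb : ∀ n i, ∀ᵐ ω ∂P, |a n ω i| ≤ α) (hind : iIndepFun a P) {M : Matrix ι ι ℝ}
    (hM : ∀ n i j, ∫ ω, a n ω i * a n ω j ∂P = M i j) (θ : ℝ) (k : ℕ) :
    Integrable (fun ω => (NormedSpace.exp (-(θ • gramSum (fun n => a n ω) k)) *
      vecMulVec (a k ω) (a k ω)).trace) P ∧
    ∫ ω, (NormedSpace.exp (-(θ • gramSum (fun n => a n ω) k)) *
      vecMulVec (a k ω) (a k ω)).trace ∂P =
    ∫ ω, (NormedSpace.exp (-(θ • gramSum (fun n => a n ω) k)) * M).trace ∂P := by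
  have hi : ∀ i j, Integrable (fun ω => NormedSpace.exp (-(θ • gramSum (fun n => a n ω) k)) i j *
      (a k ω j * a k ω i)) P := fun i j =>
    (indepFun_exp_gramSum_apply ha hind θ k i j j i).integrable_mul
      (integrable_exp_gramSum_apply ha hb θ k i j) (integrable_mul_apply ha hb k j i)
  simp only [trace, diag_apply, mul_apply, vecMulVec_apply]
  refine ⟨integrable_finsetSum _ fun i _ => integrable_finsetSum _ fun j _ => hi i j, ?_⟩
  rw [integral_finsetSum _ fun i _ => integrable_finsetSum _ fun j _ => hi i j,
    integral_finsetSum _ fun i _ => integrable_finsetSum _ fun j _ =>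
      (integrable_exp_gramSum_apply ha hb θ k i j).mul_const _]
  refine Finset.sum_congr rfl fun i _ => ?_
  rw [integral_finsetSum _ fun j _ => hi i j, integral_finsetSum _ fun j _ =>
      (integrable_exp_gramSum_apply ha hb θ k i j).mul_const _]
  refine Finset.sum_congr rfl fun j _ => ?_
  rw [(indepFun_exp_gramSum_apply ha hind θ k i j j i).integral_fun_mul_eq_mul_integral
    (integrable_exp_gramSum_apply ha hb θ k i j).aestronglyMeasurable
    (integrable_mul_apply ha hb k j i).aestronglyMeasurable, hM, integral_mul_const]

theorem integrable_trace_exp_gramSum [DecidableEq ι] (ha : ∀ n, Measurable (a n))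
    (hb : ∀ n i, ∀ᵐ ω ∂P, |a n ω i| ≤ α) (θ : ℝ) (k : ℕ) :
    Integrable (fun ω => (NormedSpace.exp (-(θ • gramSum (fun n => a n ω) k))).trace) P :=
  integrable_finsetSum _ fun i _ => integrable_exp_gramSum_apply ha hb θ k i i

theorem isHermitian_neg_smul_gramSum (x : ℕ → ι → ℝ) (θ : ℝ) (k : ℕ) :
    (-(θ • gramSum x k)).IsHermitian := by
  have h : (θ • gramSum x k).IsHermitian := by
    rw [IsHermitian, conjTranspose_smul, (posSemidef_gramSum x k).isHermitian.eq, star_trivial]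
  exact h.neg

/-- The Laplace transform bound behind the lower tail of the **matrix Chernoff inequality**. -/
theorem integral_trace_exp_gramSum_le [DecidableEq ι] (ha : ∀ n, Measurable (a n))
    (hb : ∀ n i, ∀ᵐ ω ∂P, |a n ω i| ≤ α) (hind : iIndepFun a P) {M : Matrix ι ι ℝ}
    (hM : ∀ n i j, ∫ ω, a n ω i * a n ω j ∂P = M i j) {σ : ℝ}
    (hσ : (M - σ • (1 : Matrix ι ι ℝ)).PosSemidef) {R θ : ℝ}
    (hR : ∀ n, ∀ᵐ ω ∂P, a n ω ⬝ᵥ a n ω ≤ R) (hθ : 0 ≤ θ) (hθR : θ * R ≤ 2) (k : ℕ) :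
    ∫ ω, (NormedSpace.exp (-(θ • gramSum (fun n => a n ω) k))).trace ∂P ≤
      Fintype.card ι * Real.exp (-(k * (θ * (1 - θ * R / 2) * σ))) := by
  induction k with
  | zero => simp [gramSum]
  | succ k ih =>
    set c := θ * (1 - θ * R / 2)
    have hc : 0 ≤ c := mul_nonneg hθ (by linarith)
    have hF : ∀ ω, (NormedSpace.exp (-(θ • gramSum (fun n => a n ω) k))).PosSemidef := fun ω =>
      (isHermitian_neg_smul_gramSum _ θ k).posSemidef_exp
    have hint := integrable_trace_exp_gramSum ha hb (P := P) θ k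
    obtain ⟨hint2, heq⟩ := integral_trace_exp_gramSum_mul ha hb hind hM θ k
    have hstep : ∫ ω, (NormedSpace.exp (-(θ • gramSum (fun n => a n ω) (k + 1)))).trace ∂P ≤
        ∫ ω, ((NormedSpace.exp (-(θ • gramSum (fun n => a n ω) k))).trace -
          c * (NormedSpace.exp (-(θ • gramSum (fun n => a n ω) k)) *
            vecMulVec (a k ω) (a k ω)).trace) ∂P := by
      refine integral_mono_ae (integrable_trace_exp_gramSum ha hb θ (k + 1))
        (hint.sub (hint2.const_mul c)) ?_
      filter_upwards [hR k] with ω hω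
      have h := trace_exp_neg_add_vecMulVec_le
        (posSemidef_gramSum (fun n => a n ω) k).isHermitian hω hθ
      have hs : gramSum (fun n => a n ω) (k + 1) =
          gramSum (fun n => a n ω) k + vecMulVec (a k ω) (a k ω) := Finset.sum_range_succ _ _
      rw [hs]
      exact h
    have hM2 : σ * ∫ ω, (NormedSpace.exp (-(θ • gramSum (fun n => a n ω) k))).trace ∂P ≤
        ∫ ω, (NormedSpace.exp (-(θ • gramSum (fun n => a n ω) k)) * M).trace ∂P := by
      rw [← integral_const_mul]
      refine integral_mono (hint.const_mul σ) ?_ fun ω => ?_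
      · simp only [trace, diag_apply, mul_apply]
        exact integrable_finsetSum _ fun i _ => integrable_finsetSum _ fun j _ =>
          (integrable_exp_gramSum_apply ha hb θ k i j).mul_const _
      · have h := (hF ω).trace_mul_nonneg hσ
        rw [Matrix.mul_sub, Matrix.mul_smul, mul_one, trace_sub, trace_smul, smul_eq_mul] at h
        exact sub_nonneg.mp h
    have hpos : 0 ≤ ∫ ω, (NormedSpace.exp (-(θ • gramSum (fun n => a n ω) k))).trace ∂P :=
      integral_nonneg fun ω => (hF ω).trace_nonneg
    rw [integral_sub hint (hint2.const_mul c), integral_const_mul, heq] at hstep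
    set I := ∫ ω, (NormedSpace.exp (-(θ • gramSum (fun n => a n ω) k))).trace ∂P
    calc _ ≤ _ := hstep
      -- From `tr(F M) ≥ σ tr F` for `F ≥ 0`, multiplied by `c ≥ 0`.
      _ ≤ (1 - c * σ) * I := by nlinarith
      _ ≤ Real.exp (-(c * σ)) * I := by
        gcongr
        linarith [Real.add_one_le_exp (-(c * σ))]
      _ ≤ Real.exp (-(c * σ)) * (Fintype.card ι * Real.exp (-(k * (c * σ)))) := by gcongr
      _ = _ := by
        rw [mul_left_comm, ← Real.exp_add]
        congr 2
        push_cast; ring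

/-- Lower tail of the **matrix Chernoff inequality**. -/
theorem measureReal_le_trace_exp_gramSum_le [DecidableEq ι] (ha : ∀ n, Measurable (a n))
    (hb : ∀ n i, ∀ᵐ ω ∂P, |a n ω i| ≤ α) (hind : iIndepFun a P) {M : Matrix ι ι ℝ}
    (hM : ∀ n i j, ∫ ω, a n ω i * a n ω j ∂P = M i j) {σ : ℝ}
    (hσ : (M - σ • (1 : Matrix ι ι ℝ)).PosSemidef) {R : ℝ} (hR0 : 0 < R)
    (hR : ∀ n, ∀ᵐ ω ∂P, a n ω ⬝ᵥ a n ω ≤ R) (k : ℕ) :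
    P.real {ω | Real.exp (-((2 * R)⁻¹ * (k * σ / 2))) ≤
      (NormedSpace.exp (-((2 * R)⁻¹ • gramSum (fun n => a n ω) k))).trace} ≤
      Fintype.card ι * Real.exp (-(k * σ / (8 * R))) := by
  -- With this `θ` the Laplace exponent is `-3kσ/(8R)`, and the threshold `kσ/2` costs `kσ/(4R)`,
  -- which leaves `-kσ/(8R)`.
  set θ := (2 * R)⁻¹
  have hθR : θ * R = 1 / 2 := by simp only [θ]; field_simp
  have h1 := mul_meas_ge_le_integral_of_nonneg
    (f := fun ω => (NormedSpace.exp (-(θ • gramSum (fun n => a n ω) k))).trace) (μ := P)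
    (Filter.Eventually.of_forall fun ω =>
      (isHermitian_neg_smul_gramSum _ θ k).posSemidef_exp.trace_nonneg)
    (integrable_trace_exp_gramSum ha hb θ k) (Real.exp (-(θ * (k * σ / 2))))
  have h2 := h1.trans (integral_trace_exp_gramSum_le ha hb hind hM hσ hR
    (by positivity : (0 : ℝ) ≤ θ) (by rw [hθR]; norm_num) k)
  rw [← le_div_iff₀' (Real.exp_pos _), mul_div_assoc (Fintype.card ι : ℝ), ← Real.exp_sub] at h2
  refine h2.trans_eq ?_
  congr 2
  rw [hθR]
  simp only [θ]
  field_simp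
  ring

end Chernoff

/-! ### Azuma–Hoeffding inequality -/

/-- By convexity the exponential lies below its chord over `[-b, b]`. The chord is affine in `x`, so
its linear part vanishes in conditional mean. -/
theorem Real.exp_mul_le_cosh_add {b x : ℝ} (hb : 0 < b) (hx : |x| ≤ b) (w : ℝ) :
    Real.exp (w * x) ≤ Real.cosh (w * b) + Real.sinh (w * b) / b * x := by
  obtain ⟨h1, h2⟩ := abs_le.mp hx
  have hw₁ : 0 ≤ (b + x) / (2 * b) := div_nonneg (by linarith) (by linarith)
  have hw₂ : 0 ≤ (b - x) / (2 * b) := div_nonneg (by linarith) (by linarith)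
  have hc := convexOn_exp.2 (Set.mem_univ (w * b)) (Set.mem_univ (-(w * b))) hw₁ hw₂
    (by field_simp; ring)
  simp only [smul_eq_mul] at hc
  calc Real.exp (w * x) =
        Real.exp ((b + x) / (2 * b) * (w * b) + (b - x) / (2 * b) * -(w * b)) := by
        congr 1; field_simp; ring
    _ ≤ _ := hc
    _ = _ := by rw [Real.cosh_eq, Real.sinh_eq]; field_simp; ring

section MartingaleDifference

variable {Ω : Type*} {m : MeasurableSpace Ω} {P : Measure Ω} {v : ℕ → Ω → ℝ} {ℱ : Filtration ℕ m}
  {b : ℝ}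

theorem IsMartingaleDifference.measurable (hv : IsMartingaleDifference v ℱ P) (n : ℕ) :
    Measurable (v n) :=
  ((hv.adapted n).mono (ℱ.le _)).measurable

theorem IsMartingaleDifference.stronglyMeasurable_sum (hv : IsMartingaleDifference v ℱ P)
    (w : ℕ → ℝ) (k : ℕ) :
    StronglyMeasurable[ℱ k] fun ω => ∑ l ∈ Finset.range k, w l * v l ω :=
  Finset.stronglyMeasurable_fun_sum _ fun l hl =>
    ((hv.adapted l).mono (ℱ.mono (Finset.mem_range.mp hl))).const_mul (w l)

variable [IsProbabilityMeasure P]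

theorem integrable_exp_weighted_sum (hv : IsMartingaleDifference v ℱ P)
    (hb : ∀ n, ∀ᵐ ω ∂P, |v n ω| ≤ b) (w : ℕ → ℝ) (k : ℕ) :
    Integrable (fun ω => Real.exp (∑ l ∈ Finset.range k, w l * v l ω)) P := by
  refine Integrable.of_bound (Real.measurable_exp.comp
    ((hv.stronglyMeasurable_sum w k).mono (ℱ.le k)).measurable).aestronglyMeasurable
    (Real.exp (∑ l ∈ Finset.range k, |w l| * b)) ?_
  filter_upwards [ae_all_iff.mpr hb] with ω hω
  rw [Real.norm_of_nonneg (Real.exp_pos _).le]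
  refine Real.exp_le_exp.mpr (Finset.sum_le_sum fun l _ => ?_)
  calc w l * v l ω ≤ |w l * v l ω| := le_abs_self _
    _ = |w l| * |v l ω| := abs_mul _ _
    _ ≤ _ := by gcongr; exact hω l

/-- The moment generating function bound behind the **Azuma–Hoeffding inequality**. -/
theorem integral_exp_weighted_sum_le (hv : IsMartingaleDifference v ℱ P)
    (hb : ∀ n, ∀ᵐ ω ∂P, |v n ω| ≤ b) (hb0 : 0 < b) (w : ℕ → ℝ) (k : ℕ) :
    ∫ ω, Real.exp (∑ l ∈ Finset.range k, w l * v l ω) ∂P ≤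
      Real.exp (b ^ 2 / 2 * ∑ l ∈ Finset.range k, w l ^ 2) := by
  induction k with
  | zero => simp
  | succ k ih =>
    set E := fun ω => Real.exp (∑ l ∈ Finset.range k, w l * v l ω) with hE
    have hEi : Integrable E P := integrable_exp_weighted_sum hv hb w k
    have hEm : StronglyMeasurable[ℱ k] E :=
      Real.continuous_exp.comp_stronglyMeasurable (hv.stronglyMeasurable_sum w k)
    have hEv : Integrable (E * v k) P :=
      hEi.mul_bdd (c := b) (hv.measurable k).aestronglyMeasurable (by simpa using hb k)
    -- `E` is known at time `k` and can be pulled out of the conditional expectation.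
    have hzero : ∫ ω, E ω * v k ω ∂P = 0 := by
      have h1 : P[E * v k | ℱ k] =ᵐ[P] 0 := by
        filter_upwards [condExp_mul_of_stronglyMeasurable_left hEm hEv (hv.integrable k),
          hv.condExp_eq_zero k] with ω h1 h2
        rw [h1, Pi.mul_apply, h2, Pi.zero_apply, mul_zero]
      have h2 := integral_condExp (ℱ.le k) (μ := P) (f := E * v k)
      rw [integral_congr_ae h1] at h2
      simpa using h2.symm
    have hEv' : Integrable (fun ω => E ω * v k ω) P := hEv
    calc ∫ ω, Real.exp (∑ l ∈ Finset.range (k + 1), w l * v l ω) ∂P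
        ≤ ∫ ω, (Real.cosh (w k * b) * E ω + Real.sinh (w k * b) / b * (E ω * v k ω)) ∂P := by
          refine integral_mono_ae (integrable_exp_weighted_sum hv hb w (k + 1))
            ((hEi.const_mul _).add (hEv'.const_mul _)) ?_
          filter_upwards [hb k] with ω hω
          rw [Finset.sum_range_succ, Real.exp_add]
          have h := mul_le_mul_of_nonneg_left (Real.exp_mul_le_cosh_add hb0 hω (w k))
            (Real.exp_pos (∑ l ∈ Finset.range k, w l * v l ω)).le
          refine h.trans_eq ?_
          simp only [hE]; ring
      _ = Real.cosh (w k * b) * ∫ ω, E ω ∂P := by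
          rw [integral_add (hEi.const_mul _) (hEv'.const_mul _), integral_const_mul,
            integral_const_mul, hzero, mul_zero, add_zero]
      _ ≤ Real.exp ((w k * b) ^ 2 / 2) *
            Real.exp (b ^ 2 / 2 * ∑ l ∈ Finset.range k, w l ^ 2) := by
          gcongr
          exact Real.cosh_le_exp_half_sq _
      _ = _ := by
          rw [← Real.exp_add, Finset.sum_range_succ]
          congr 1; ring

theorem measureReal_weighted_sum_ge_le (hv : IsMartingaleDifference v ℱ P)
    (hb : ∀ n, ∀ᵐ ω ∂P, |v n ω| ≤ b) (hb0 : 0 < b) (w : ℕ → ℝ) (k : ℕ) {W r : ℝ} (hW : 0 < W)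
    (hw : ∑ l ∈ Finset.range k, w l ^ 2 ≤ W) (hr : 0 < r) :
    P.real {ω | r ≤ ∑ l ∈ Finset.range k, w l * v l ω} ≤
      Real.exp (-(r ^ 2 / (2 * b ^ 2 * W))) := by
  -- Minimiser of `b² t² W / 2 - t r`.
  set t := r / (b ^ 2 * W)
  have ht : 0 < t := by positivity
  have h1 := mul_meas_ge_le_integral_of_nonneg (μ := P)
    (f := fun ω => Real.exp (∑ l ∈ Finset.range k, (t * w l) * v l ω))
    (Filter.Eventually.of_forall fun ω => (Real.exp_pos _).le)
    (integrable_exp_weighted_sum hv hb (fun l => t * w l) k) (Real.exp (t * r))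
  have h2 := h1.trans (integral_exp_weighted_sum_le hv hb hb0 (fun l => t * w l) k)
  have hset : {ω | Real.exp (t * r) ≤ Real.exp (∑ l ∈ Finset.range k, (t * w l) * v l ω)} =
      {ω | r ≤ ∑ l ∈ Finset.range k, w l * v l ω} := by
    ext ω
    simp only [Set.mem_ofPred_eq, Real.exp_le_exp, mul_assoc, ← Finset.mul_sum]
    exact mul_le_mul_iff_right₀ ht
  rw [hset, ← le_div_iff₀' (Real.exp_pos _), ← Real.exp_sub] at h2
  refine h2.trans (Real.exp_le_exp.mpr ?_)
  simp only [mul_pow, ← Finset.mul_sum]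
  calc b ^ 2 / 2 * (t ^ 2 * ∑ l ∈ Finset.range k, w l ^ 2) - t * r
      ≤ b ^ 2 / 2 * (t ^ 2 * W) - t * r := by gcongr
    _ = _ := by simp only [t]; field_simp; ring

/-- The two-sided **Azuma–Hoeffding inequality** for weighted sums. -/
theorem measureReal_abs_weighted_sum_gt_le (hv : IsMartingaleDifference v ℱ P)
    (hb : ∀ n, ∀ᵐ ω ∂P, |v n ω| ≤ b) (hb0 : 0 < b) (w : ℕ → ℝ) (k : ℕ) {W r : ℝ} (hW : 0 < W)
    (hw : ∑ l ∈ Finset.range k, w l ^ 2 ≤ W) (hr : 0 < r) :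
    P.real {ω | r < |∑ l ∈ Finset.range k, w l * v l ω|} ≤
      2 * Real.exp (-(r ^ 2 / (2 * b ^ 2 * W))) := by
  have h1 := measureReal_weighted_sum_ge_le hv hb hb0 w k hW hw hr
  have h2 := measureReal_weighted_sum_ge_le hv hb hb0 (fun l => -w l) k hW (by simpa using hw) hr
  rw [two_mul]
  refine (measureReal_mono ?_).trans ((measureReal_union_le _ _).trans (add_le_add h1 h2))
  intro ω hω
  rw [Set.mem_ofPred_eq, lt_abs] at hω
  rcases hω with h | h
  · exact Or.inl h.le
  · refine Or.inr ?_
    simpa only [Set.mem_ofPred_eq, neg_mul, Finset.sum_neg_distrib] using h.le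

end MartingaleDifference

/-! ### Freezing an independent variable -/

/-- Fubini: the joint law is a product, and every section has measure at most `c`. This replaces
conditioning on the design. -/
theorem ProbabilityTheory.IndepFun.measureReal_le_of_forall {Ω E F : Type*} {m : MeasurableSpace Ω}
    [MeasurableSpace E] [MeasurableSpace F] {P : Measure Ω} [IsProbabilityMeasure P] {X : Ω → E}
    {Y : Ω → F} (h : IndepFun X Y P) (hX : Measurable X) (hY : Measurable Y) {B : Set (E × F)}
    (hB : MeasurableSet B) {c : ℝ} (hc : ∀ y, P.real {ω | (X ω, y) ∈ B} ≤ c) :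
    P.real {ω | (X ω, Y ω) ∈ B} ≤ c := by
  have hPX := Measure.isProbabilityMeasure_map (μ := P) hX.aemeasurable
  have hPY := Measure.isProbabilityMeasure_map (μ := P) hY.aemeasurable
  obtain ⟨ω₀⟩ : Nonempty Ω := nonempty_of_isProbabilityMeasure P
  have hc0 : 0 ≤ c := measureReal_nonneg.trans (hc (Y ω₀))
  refine ENNReal.toReal_le_of_le_ofReal hc0 ?_
  have h1 : P {ω | (X ω, Y ω) ∈ B} = (P.map X).prod (P.map Y) B := by
    rw [← (indepFun_iff_map_prod_eq_prod_map_map hX.aemeasurable hY.aemeasurable).mp h,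
      Measure.map_apply (hX.prodMk hY) hB]
    rfl
  rw [h1, Measure.prod_apply_symm hB]
  calc ∫⁻ y, P.map X ((fun x => (x, y)) ⁻¹' B) ∂P.map Y
      ≤ ∫⁻ _, ENNReal.ofReal c ∂P.map Y := lintegral_mono fun y => by
        rw [Measure.map_apply hX (measurable_prodMk_right hB)]
        exact (ENNReal.le_ofReal_iff_toReal_le (measure_ne_top _ _) hc0).mpr (hc y)
    _ = ENNReal.ofReal c := by simp

/-! ### The least squares error -/

section LeastSquares

open Matrix

variable {p : ℕ}

theorem designMatrix_transpose_mul_self (x : ℕ → Fin p → ℝ) (N : ℕ) :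
    (designMatrix x N)ᵀ * designMatrix x N = gramSum x N := by
  ext i j
  simp only [mul_apply, transpose_apply, designMatrix, of_apply, gramSum, Matrix.sum_apply,
    vecMulVec_apply]
  exact Fin.sum_univ_eq_sum_range (fun n => x n i * x n j) N

theorem leastSquares_observation_sub_apply (x : ℕ → Fin p → ℝ) (u : ℕ → ℝ) (θ₀ : Fin p → ℝ)
    (N : ℕ) (h : IsUnit (gramSum x N)) (i : Fin p) :
    (leastSquares (designMatrix x N) (observation x u θ₀ N) - θ₀) i =
      ∑ l ∈ Finset.range N, ((gramSum x N)⁻¹ *ᵥ x l) i * u l := by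
  have hdet : IsUnit (gramSum x N).det := (isUnit_iff_isUnit_det _).mp h
  have h1 : leastSquares (designMatrix x N) (observation x u θ₀ N) - θ₀ =
      (gramSum x N)⁻¹ *ᵥ ((designMatrix x N)ᵀ *ᵥ fun n : Fin N => u n) := by
    rw [leastSquares, observation, mulVec_add, mulVec_mulVec,
      designMatrix_transpose_mul_self, mulVec_add, mulVec_mulVec, nonsing_inv_mul _ hdet, one_mulVec,
      add_sub_cancel_left]
  rw [h1, ← Fin.sum_univ_eq_sum_range (fun l => ((gramSum x N)⁻¹ *ᵥ x l) i * u l)]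
  simp only [mulVec, dotProduct, transpose_apply, designMatrix, of_apply, Finset.mul_sum,
    Finset.sum_mul]
  rw [Finset.sum_comm]
  simp only [mul_assoc]

/-- The sum is the `(i, i)` entry of `G⁻¹ G (G⁻¹)ᵀ`, with `G` the Gram matrix. -/
theorem sum_inv_gramSum_mulVec_sq (x : ℕ → Fin p → ℝ) (N : ℕ) (h : IsUnit (gramSum x N))
    (i : Fin p) :
    ∑ l ∈ Finset.range N, ((gramSum x N)⁻¹ *ᵥ x l) i ^ 2 = (gramSum x N)⁻¹ i i := by
  have hdet : IsUnit (gramSum x N).det := (isUnit_iff_isUnit_det _).mp h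
  have hsymm : ((gramSum x N)⁻¹)ᵀ = (gramSum x N)⁻¹ := by
    simpa using (posSemidef_gramSum x N).isHermitian.inv.eq
  have h1 : (gramSum x N)⁻¹ = (gramSum x N)⁻¹ * gramSum x N * ((gramSum x N)⁻¹)ᵀ := by
    rw [nonsing_inv_mul _ hdet, hsymm, one_mul]
  conv_rhs => rw [h1]
  generalize (gramSum x N)⁻¹ = G
  rw [gramSum, Matrix.mul_sum, Matrix.sum_mul, Matrix.sum_apply]
  refine Finset.sum_congr rfl fun l _ => ?_
  rw [mul_vecMulVec, vecMulVec_mul, vecMul_transpose, vecMulVec_apply, pow_two]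

theorem continuous_gramSum (N : ℕ) :
    Continuous fun x : ℕ → Fin p → ℝ => gramSum x N :=
  continuous_finsetSum _ fun k _ => (continuous_apply k).matrix_vecMulVec (continuous_apply k)

theorem measurable_inv_gramSum_apply (N : ℕ) (i j : Fin p) :
    Measurable fun x : ℕ → Fin p → ℝ => (gramSum x N)⁻¹ i j := by
  simp only [Matrix.inv_def, Matrix.smul_apply, Ring.inverse_eq_inv', smul_eq_mul]
  exact (continuous_gramSum N).matrix_det.measurable.inv.mul
    ((continuous_gramSum N).matrix_adjugate.matrix_elem i j).measurable

variable {Ω : Type*} {m : MeasurableSpace Ω} {P : Measure Ω} [IsProbabilityMeasure P]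
  {a : ℕ → Ω → Fin p → ℝ} {v : ℕ → Ω → ℝ} {ℱ : Filtration ℕ m} {b : ℝ}

/-- On the event that the trace exponential of the Gram matrix is small, every coordinate of the
estimation error concentrates. -/
theorem measureReal_error_coordinate_le (ha : ∀ n, Measurable (a n))
    (hv : IsMartingaleDifference v ℱ P)
    (hindep : IndepFun (fun ω n => v n ω) (fun ω n => a n ω) P)
    (hb : ∀ n, ∀ᵐ ω ∂P, |v n ω| ≤ b) (hb0 : 0 < b) {θ c r : ℝ} (hθ : 0 < θ) (hc : 0 < c)
    (hr : 0 < r) (N : ℕ) (i : Fin p) :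
    P.real {ω | (NormedSpace.exp (-(θ • gramSum (fun n => a n ω) N))).trace <
        Real.exp (-(θ * c)) ∧
      r < |∑ l ∈ Finset.range N, ((gramSum (fun n => a n ω) N)⁻¹ *ᵥ a l ω) i * v l ω|} ≤
      2 * Real.exp (-(r ^ 2 * c / (2 * b ^ 2))) := by
  let B : Set ((ℕ → ℝ) × (ℕ → Fin p → ℝ)) := {z |
    (NormedSpace.exp (-(θ • gramSum z.2 N))).trace < Real.exp (-(θ * c)) ∧
      r < |∑ l ∈ Finset.range N, ((gramSum z.2 N)⁻¹ *ᵥ z.2 l) i * z.1 l|}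
  have hB : MeasurableSet B := by
    have h1 : Measurable fun z : (ℕ → ℝ) × (ℕ → Fin p → ℝ) =>
        (NormedSpace.exp (-(θ • gramSum z.2 N))).trace := by
      have h : Continuous fun x : ℕ → Fin p → ℝ =>
          (NormedSpace.exp (-(θ • gramSum x N))).trace :=
        (continuous_exp.comp ((continuous_gramSum N).const_smul θ).neg).matrix_trace
      exact h.measurable.comp measurable_snd
    have h2 : Measurable fun z : (ℕ → ℝ) × (ℕ → Fin p → ℝ) =>
        |∑ l ∈ Finset.range N, ((gramSum z.2 N)⁻¹ *ᵥ z.2 l) i * z.1 l| := by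
      refine (Finset.measurable_fun_sum _ fun l _ => ?_).abs
      refine Measurable.mul ?_ (by fun_prop)
      simp only [mulVec, dotProduct]
      refine Finset.measurable_fun_sum _ fun j _ => Measurable.mul ?_ (by fun_prop)
      exact (measurable_inv_gramSum_apply N i j).comp measurable_snd
    exact (measurableSet_lt h1 measurable_const).inter (measurableSet_lt measurable_const h2)
  refine hindep.measureReal_le_of_forall (measurable_pi_lambda _ fun n => hv.measurable n)
    (measurable_pi_lambda _ fun n => ha n) hB fun x => ?_
  by_cases hx : (NormedSpace.exp (-(θ • gramSum x N))).trace < Real.exp (-(θ * c))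
  · have hpsd := (posSemidef_gramSum x N).isHermitian.posSemidef_sub_smul_one_of_trace_exp_lt hθ hx
    have hu := (posDef_of_posSemidef_sub_smul_one hc hpsd).isUnit
    have hw : ∑ l ∈ Finset.range N, ((gramSum x N)⁻¹ *ᵥ x l) i ^ 2 ≤ 1 / c := by
      rw [sum_inv_gramSum_mulVec_sq x N hu i]
      exact inv_diag_le_of_posSemidef_sub_smul_one hc hpsd i
    have h := measureReal_abs_weighted_sum_gt_le hv hb hb0
      (fun l => ((gramSum x N)⁻¹ *ᵥ x l) i) N (by positivity) hw hr
    have hexp : r ^ 2 / (2 * b ^ 2 * (1 / c)) = r ^ 2 * c / (2 * b ^ 2) := by field_simp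
    rw [hexp] at h
    exact (measureReal_mono fun ω hω => hω.2).trans h
  -- The trace condition involves only the design, so the section at a bad design is empty.
  · have hempty : {ω | ((fun n => v n ω), x) ∈ B} = ∅ := by
      ext ω
      simp only [Set.mem_empty_iff_false, iff_false]
      exact fun h => hx h.1
    rw [hempty, measureReal_empty]
    positivity

/-- A failure bound for the least squares estimator in terms of separate tails for the Gram matrix
and for the noise. -/
theorem measureReal_leastSquares_failure_le (ha : ∀ n, Measurable (a n)) {α : ℝ}
    (hind : iIndepFun a P) (hα : ∀ n i, ∀ᵐ ω ∂P, |a n ω i| ≤ α)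
    {M : Matrix (Fin p) (Fin p) ℝ} (hM : ∀ n i j, ∫ ω, a n ω i * a n ω j ∂P = M i j) {σ : ℝ}
    (hσ0 : 0 < σ) (hσ : (M - σ • (1 : Matrix (Fin p) (Fin p) ℝ)).PosSemidef) {R : ℝ}
    (hR0 : 0 < R) (hR : ∀ n, ∀ᵐ ω ∂P, a n ω ⬝ᵥ a n ω ≤ R)
    (hv : IsMartingaleDifference v ℱ P)
    (hindep : IndepFun (fun ω n => v n ω) (fun ω n => a n ω) P)
    (hb : ∀ n, ∀ᵐ ω ∂P, |v n ω| ≤ b) (hb0 : 0 < b) (θ₀ : Fin p → ℝ) {r : ℝ} (hr : 0 < r)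
    {N : ℕ} (hN : 0 < N) :
    P.real {ω | ¬ IsUnit ((designMatrix (fun n => a n ω) N)ᵀ *
          designMatrix (fun n => a n ω) N) ∨
        r < ‖leastSquares (designMatrix (fun n => a n ω) N)
          (observation (fun n => a n ω) (fun n => v n ω) θ₀ N) - θ₀‖} ≤
      p * Real.exp (-(N * σ / (8 * R))) +
        p * (2 * Real.exp (-(r ^ 2 * (N * σ / 2) / (2 * b ^ 2)))) := by
  set θ := (2 * R)⁻¹
  have hθ : 0 < θ := by positivity
  set c := N * σ / 2
  have hc : 0 < c := by positivity
  let bad : Set Ω := {ω | Real.exp (-(θ * c)) ≤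
    (NormedSpace.exp (-(θ • gramSum (fun n => a n ω) N))).trace}
  let err : Fin p → Set Ω := fun i =>
    {ω | (NormedSpace.exp (-(θ • gramSum (fun n => a n ω) N))).trace < Real.exp (-(θ * c)) ∧
      r < |∑ l ∈ Finset.range N, ((gramSum (fun n => a n ω) N)⁻¹ *ᵥ a l ω) i * v l ω|}
  have hbad : P.real bad ≤ p * Real.exp (-(N * σ / (8 * R))) := by
    have h := measureReal_le_trace_exp_gramSum_le ha hα hind hM hσ hR0 hR N
    rwa [Fintype.card_fin] at h
  have herr : P.real (⋃ i, err i) ≤ p * (2 * Real.exp (-(r ^ 2 * c / (2 * b ^ 2)))) := by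
    refine (measureReal_iUnion_fintype_le _).trans ?_
    refine (Finset.sum_le_sum fun i _ =>
      measureReal_error_coordinate_le ha hv hindep hb hb0 hθ hc hr N i).trans_eq ?_
    simp
  refine (measureReal_mono ?_).trans ((measureReal_union_le bad (⋃ i, err i)).trans
    (add_le_add hbad herr))
  intro ω hω
  by_cases hω' : ω ∈ bad
  · exact Or.inl hω'
  · refine Or.inr ?_
    have hx : (NormedSpace.exp (-(θ • gramSum (fun n => a n ω) N))).trace <
        Real.exp (-(θ * c)) := not_le.mp hω'
    have hpsd := (posSemidef_gramSum
      (fun n => a n ω) N).isHermitian.posSemidef_sub_smul_one_of_trace_exp_lt hθ hx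
    have hu := (posDef_of_posSemidef_sub_smul_one hc hpsd).isUnit
    rw [Set.mem_ofPred_eq, designMatrix_transpose_mul_self] at hω
    have hnorm := hω.resolve_left (not_not.mpr hu)
    obtain ⟨i, hi⟩ : ∃ i, r < ‖(leastSquares (designMatrix (fun n => a n ω) N)
        (observation (fun n => a n ω) (fun n => v n ω) θ₀ N) - θ₀) i‖ := by
      by_contra! hall
      exact hnorm.not_ge ((pi_norm_le_iff_of_nonneg hr.le).mpr hall)
    rw [leastSquares_observation_sub_apply _ _ _ _ hu, Real.norm_eq_abs] at hi
    exact Set.mem_iUnion.mpr ⟨i, hx, hi⟩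

end LeastSquares

/-! ### Second moments of the rows -/

section SecondMoment

open Matrix

variable {Ω : Type*} {m : MeasurableSpace Ω} {P : Measure Ω} {p : ℕ}
  {a : ℕ → Ω → Fin p → ℝ} {α : ℝ} {M : Matrix (Fin p) (Fin p) ℝ}

theorem ae_dotProduct_self_le (hα : ∀ n i, ∀ᵐ ω ∂P, |a n ω i| ≤ α) (n : ℕ) :
    ∀ᵐ ω ∂P, a n ω ⬝ᵥ a n ω ≤ p * α ^ 2 := by
  filter_upwards [ae_all_iff.mpr (hα n)] with ω hω
  calc a n ω ⬝ᵥ a n ω ≤ ∑ _i : Fin p, α ^ 2 := Finset.sum_le_sum fun i _ => by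
        rw [← pow_two]
        exact sq_le_sq' (abs_le.mp (hω i)).1 (abs_le.mp (hω i)).2
    _ = p * α ^ 2 := by simp

variable [IsProbabilityMeasure P]

/-- Since the averages equal `M` for every `N`, differencing the sums at `n + 1` and `n` isolates
the second moment of a single row. -/
theorem integral_mul_eq_of_mean_gram_eq (ha : ∀ n, Measurable (a n))
    (hα : ∀ n i, ∀ᵐ ω ∂P, |a n ω i| ≤ α)
    (hM : ∀ N : ℕ, 0 < N → ∀ i j, M i j = (1 / (N : ℝ)) *
      ∫ ω, ((designMatrix (fun n => a n ω) N).transpose *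
        designMatrix (fun n => a n ω) N) i j ∂P) (n : ℕ) (i j : Fin p) :
    ∫ ω, a n ω i * a n ω j ∂P = M i j := by
  have hsum : ∀ N : ℕ, ∑ l ∈ Finset.range N, ∫ ω, a l ω i * a l ω j ∂P = N * M i j := by
    intro N
    rcases N.eq_zero_or_pos with rfl | hN
    · simp
    · have hN0 : (N : ℝ) ≠ 0 := by positivity
      rw [hM N hN i j, ← integral_finsetSum _ fun l _ => integrable_mul_apply ha hα l i j,
        ← mul_assoc, mul_one_div_cancel hN0, one_mul]
      simp only [designMatrix_transpose_mul_self, gramSum, Matrix.sum_apply, vecMulVec_apply]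
  have h := hsum (n + 1)
  rw [Finset.sum_range_succ, hsum n] at h
  push_cast at h
  linarith

theorem second_moment_diag_le (ha : ∀ n, Measurable (a n))
    (hα : ∀ n i, ∀ᵐ ω ∂P, |a n ω i| ≤ α) (hM : ∀ n i j, ∫ ω, a n ω i * a n ω j ∂P = M i j)
    (i : Fin p) : M i i ≤ α ^ 2 := by
  rw [← hM 0 i i]
  calc ∫ ω, a 0 ω i * a 0 ω i ∂P ≤ ∫ _, α ^ 2 ∂P := by
        refine integral_mono_ae (integrable_mul_apply ha hα 0 i i) (integrable_const _) ?_
        filter_upwards [hα 0 i] with ω hω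
        rw [← pow_two]
        exact sq_le_sq' (abs_le.mp hω).1 (abs_le.mp hω).2
    _ = α ^ 2 := by simp

end SecondMoment

/-! ### Numerical constants and conclusion -/

theorem gram_tail_lt {p N σ s R ε : ℝ} (hp : 0 < p) (hσ : 0 < σ) (hs : σ ≤ s) (hR : 0 < R)
    (hε : 0 < ε) (hL : 0 < Real.log (2 * p / ε))
    (hN : 4 / 3 * ((6 * s + σ) * (R + s) / σ ^ 2) * Real.log (2 * p / ε) < N) :
    p * Real.exp (-(N * σ / (8 * R))) < ε / 2 := by
  set L := Real.log (2 * p / ε) with hLdef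
  have hexp : Real.exp (-L) = ε / (2 * p) := by
    rw [Real.exp_neg, hLdef, Real.exp_log (by positivity), inv_div]
  have hkey : L < N * σ / (8 * R) := by
    rw [lt_div_iff₀ (by positivity)]
    -- As `s ≥ σ`, the assumption yields `N σ > (28/3) R L`, more than the `8 R L` needed.
    have h1 : 7 * σ * R ≤ (6 * s + σ) * (R + s) :=
      mul_le_mul (by linarith) (by linarith) hR.le (by linarith)
    have h2 : 4 / 3 * (7 * σ * R / σ ^ 2) * L ≤
        4 / 3 * ((6 * s + σ) * (R + s) / σ ^ 2) * L := by gcongr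
    have h3 : 4 / 3 * (7 * σ * R / σ ^ 2) * L * σ < N * σ := by
      gcongr
      exact h2.trans_lt hN
    have h4 : 4 / 3 * (7 * σ * R / σ ^ 2) * L * σ = 28 / 3 * (L * R) := by field_simp; ring
    have h5 : 0 < L * R := by positivity
    linarith
  calc p * Real.exp (-(N * σ / (8 * R))) < p * Real.exp (-L) := by gcongr
    _ = ε / 2 := by rw [hexp]; field_simp

/-- The exponent is `2 L α²/σ ≥ 2 L`, so the left side is at most `2p (ε/(2p))² = ε²/(2p)`, and `ε ≤
1 ≤ p`. -/
theorem noise_tail_le {p N σ α r ε b : ℝ} (hp : 1 ≤ p) (hσ : 0 < σ) (hσα : σ ≤ α ^ 2)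
    (hε : 0 < ε) (hε1 : ε ≤ 1) (hr : 0 < r) (hN : 0 < N) (hL : 0 < Real.log (2 * p / ε))
    (hb : b ^ 2 = N * (r ^ 2 * σ ^ 2) / (8 * α ^ 2 * Real.log (2 * p / ε))) :
    p * (2 * Real.exp (-(r ^ 2 * (N * σ / 2) / (2 * b ^ 2)))) ≤ ε / 2 := by
  set L := Real.log (2 * p / ε) with hLdef
  have hα : 0 < α ^ 2 := hσ.trans_le hσα
  have hexp : Real.exp (-(L + L)) = (ε / (2 * p)) ^ 2 := by
    rw [Real.exp_neg, Real.exp_add, hLdef, Real.exp_log (by positivity), ← pow_two, ← inv_pow,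
      inv_div]
  have hkey : L + L ≤ r ^ 2 * (N * σ / 2) / (2 * b ^ 2) := by
    have h1 : r ^ 2 * (N * σ / 2) / (2 * b ^ 2) = 2 * L * (α ^ 2 / σ) := by
      rw [hb]; field_simp; ring
    have h2 : 1 ≤ α ^ 2 / σ := (one_le_div hσ).mpr hσα
    rw [h1]
    nlinarith
  calc p * (2 * Real.exp (-(r ^ 2 * (N * σ / 2) / (2 * b ^ 2))))
      ≤ p * (2 * Real.exp (-(L + L))) := by gcongr
    _ = ε / 2 * (ε / p) := by rw [hexp]; field_simp
    _ ≤ ε / 2 * 1 := by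
        gcongr
        exact (div_le_one (by linarith)).mpr (hε1.trans hp)
    _ = ε / 2 := mul_one _

theorem theorem4 {Ω : Type*} {m : MeasurableSpace Ω} (P : Measure Ω) [IsProbabilityMeasure P]
    {p : ℕ} (a : ℕ → Ω → Fin p → ℝ) (v : ℕ → Ω → ℝ) (ℱ : Filtration ℕ m)
    (θ₀ : Fin p → ℝ) (M : Matrix (Fin p) (Fin p) ℝ) (α b : ℝ)
    -- the rows of the random design are independent random vectors
    (ha_meas : ∀ n, Measurable (a n))
    (ha_indep : iIndepFun a P)
    -- bounded entries
    (ha_bdd : ∀ n i, ∀ᵐ ω ∂P, |a n ω i| ≤ α)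
    -- `M = (1 / N) E (Aᵀ A)` for every number of samples `N > 0`, and `M` is nondegenerate
    (hM : ∀ N : ℕ, 0 < N → ∀ i j, M i j = (1 / (N : ℝ)) *
      ∫ ω, ((designMatrix (fun n => a n ω) N).transpose *
        designMatrix (fun n => a n ω) N) i j ∂P)
    (hM_pos : 0 < lambdaMin M)
    -- bounded martingale difference noise, independent of the design
    (hv_mds : IsMartingaleDifference v ℱ P)
    (hv_indep : IndepFun (fun ω n => v n ω) (fun ω n => a n ω) P)
    (hv_bdd : ∀ n, ∀ᵐ ω ∂P, |v n ω| ≤ b)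
    (ε r : ℝ) (hε : 0 < ε) (hr : 0 < r) (N : ℕ)
    (hN : (N : ℝ) > max
      (8 * α ^ 2 * b ^ 2 / (r ^ 2 * lambdaMin M ^ 2) * Real.log (2 * p / ε))
      (4 / 3 * ((6 * lambdaMax M + lambdaMin M) * (p * α ^ 2 + lambdaMax M) / lambdaMin M ^ 2) *
        Real.log (2 * p / ε))) :
    -- the event in which the estimator is undefined counts as a failure
    P.real {ω | ¬ IsUnit ((designMatrix (fun n => a n ω) N).transpose *
          designMatrix (fun n => a n ω) N) ∨
        r < ‖leastSquares (designMatrix (fun n => a n ω) N)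
          (observation (fun n => a n ω) (fun n => v n ω) θ₀ N) - θ₀‖} < ε := by
  rcases p.eq_zero_or_pos with rfl | hp
  · exact absurd hM_pos (by rw [lambdaMin_of_isEmpty]; exact lt_irrefl 0)
  have : NeZero p := ⟨hp.ne'⟩
  have hp1 : (1 : ℝ) ≤ p := by exact_mod_cast hp
  -- For `ε > 1` the bound is trivial; for `ε ≤ 1` the logarithm is positive.
  rcases lt_or_ge 1 ε with hε1 | hε1
  · exact measureReal_le_one.trans_lt hε1
  have hM' := integral_mul_eq_of_mean_gram_eq ha_meas ha_bdd hM
  have hMh : M.IsHermitian := by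
    ext i j
    rw [Matrix.conjTranspose_apply, star_trivial, ← hM' 0 j i, ← hM' 0 i j]
    simp only [mul_comm]
  have hσ := hMh.posSemidef_sub_smul_one fun x hx => lambdaMin_le_of_mem_spectrum hx
  have hs := lambdaMin_le_lambdaMax hMh
  set σ := lambdaMin M
  -- Compare diagonal entries: `σ ≤ M 0 0 ≤ α²`.
  have hσα : σ ≤ α ^ 2 := by
    have h := hσ.diag_nonneg (i := 0)
    simp only [Matrix.sub_apply, Matrix.smul_apply, Matrix.one_apply_eq, smul_eq_mul,
      mul_one] at h
    exact (sub_nonneg.mp h).trans (second_moment_diag_le ha_meas ha_bdd hM' 0)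
  have hα : 0 < α ^ 2 := hM_pos.trans_le hσα
  have hR : 0 < p * α ^ 2 := by positivity
  have hL : 0 < Real.log (2 * p / ε) :=
    Real.log_pos ((one_lt_div hε).mpr (by linarith))
  obtain ⟨hN1, hN2⟩ := max_lt_iff.mp hN
  have hN0 : (0 : ℝ) < N := lt_of_le_of_lt (by positivity) hN1
  -- The value of `b²` at which the first lower bound on `N` becomes an equality. Using `√C` as
  -- noise bound in place of `b` also covers `b = 0`, since `C > 0`.
  set C := N * (r ^ 2 * σ ^ 2) / (8 * α ^ 2 * Real.log (2 * p / ε))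
  have hC : 0 < C := by positivity
  have hbC : b ^ 2 ≤ C := by
    rw [le_div_iff₀ (by positivity)]
    rw [div_mul_eq_mul_div, div_lt_iff₀ (by positivity)] at hN1
    linarith
  have hb : ∀ n, ∀ᵐ ω ∂P, |v n ω| ≤ √C := fun n =>
    (hv_bdd n).mono fun ω hω => hω.trans (Real.le_sqrt_of_sq_le hbC)
  refine (measureReal_leastSquares_failure_le ha_meas ha_indep ha_bdd hM' hM_pos hσ hR
    (ae_dotProduct_self_le ha_bdd) hv_mds hv_indep hb (Real.sqrt_pos.mpr hC) θ₀ hr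
    (by exact_mod_cast hN0)).trans_lt ?_
  have h1 := gram_tail_lt (by linarith) hM_pos hs hR hε hL hN2
  have h2 := noise_tail_le hp1 hM_pos hσα hε hε1 hr hN0 hL (Real.sq_sqrt hC.le)
  linarith
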